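/- Let $\mathbb{R}^n$, $\mathbb{R}^m$ and their products carry the Euclidean norms, and let $\mathbb{B}_R$ denote the closed ball of radius $R$ centred at $0$, $\mathbb{B}=\mathbb{B}_1$. Let $F\colon\mathbb{R}^n\rightrightarrows\mathbb{R}^m$ be a set-valued mapping whose graph $\mathrm{gph}\,F=\{(x,y) : y\in F(x)\}$ is closed, and write $F^{-1}(V)=\{x : F(x)\cap V\neq\emptyset\}$. Let $\overline{y}\in\mathbb{R}^m$ be such that there are $(x_k,y_k)\in\mathrm{gph}\,F$ with $\|x_k\|\to\infty$ and $y_k\to\overline{y}$. Below, $(x_k,y_k)\xrightarrow{\mathrm{gph} F}(\infty,\overline{y})$ means that $(x_k,y_k)\in\mathrm{gph}\,F$, $\|x_k\|\to\infty$ and $y_k\to\overline{y}$. For a set $\Omega$ in a Euclidean space and $z\in\Omega$, the regular normal cone $\widehat{N}_\Omega(z)$ is the set of all $\xi$ with $\langle\xi,z'-z\rangle\le o(\|z'-z\|)$ as $z'\to z$, $z'\in\Omega$; the limiting normal cone $N_\Omega(z)$ is the set of all limits of sequences $\xi_k\in\widehat{N}_\Omega(z_k)$ with $z_k\in\Omega$,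 $z_k\to z$. For an extended-real-valued function $f$ and a point $z$ with $f(z)$ finite, the limiting subdifferential is $\partial f(z)=\{w : (w,-1)\in N_{\mathrm{epi} f}(z,f(z))\}$, where $\mathrm{epi} f=\{(z,r) : f(z)\le r\}$. The coderivative $D^*F(\infty,\overline{y})(v)$ is the set of all $u\in\mathbb{R}^n$ such that $(u,-v)$ is the limit of a sequence $\xi_k\in\widehat{N}_{\mathrm{gph} F}(x_k,y_k)$ with $(x_k,y_k)\xrightarrow{\mathrm{gph} F}(\infty,\overline{y})$. Let $d_F(x,y)=\inf\{\|y-v\| : v\in F(x)\}\in[0,+\infty]$ (with $\inf\emptyset=+\infty$). Let $\mathscr{F}\subset\mathbb{R}^n\times\mathbb{R}^m$ be the set of all limits of sequences $w_k\in\partial d_F(x_k,y_k)$, and let $\mathscr{F}^\infty\subset\mathbb{R}^n\times\mathbb{R}^m$ be the set of all limits of sequences $r_kw_k$ with $w_k\in\partial d_F(x_k,y_k)$, $r_k>0$ and $r_k\to0$, where in both cases $(x_k,y_k)\xrightarrow{\mathrm{gph} F}(\infty,\overline{y})$. The following conditions are equivalent: (i) $D^*F(\infty,\overline{y})(0)=\{0\}$.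 (ii) There exist constants $R>0$, $\ell>0$ and an open neighborhood $V$ of $\overline{y}$ such that the set $F^{-1}(V)\setminus\mathbb{B}_R$ is open and $$F(x)\cap V\subset F(x')+\ell\|x-x'\|\mathbb{B}\quad\text{for all } x,x'\in F^{-1}(V)\setminus\mathbb{B}_R.$$ (iii) There exist constants $R>0$, $\ell>0$ and a neighborhood $V$ of $\overline{y}$ such that each point of $\mathrm{gph}\,F\cap\big((\mathbb{R}^n\setminus\mathbb{B}_R)\times V\big)$ has a neighborhood on which $d_F$ is finite and Lipschitz continuous with modulus $\ell$. (iv) $\mathscr{F}^\infty=\{0\}$. Moreover, whenever (iii) holds with constants $R,\ell$ and a neighborhood $V$, one has $\|w\|\le\ell$ for all $w\in\mathscr{F}$. -/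

import Mathlib

open Filter Topology
open scoped Pointwise RealInnerProductSpace

noncomputable section

namespace VarAnal

/-- The Painleve-Kuratowski outer limit of the set-valued map `Φ` along the filter `l`: all limits of
sequences `b k ∈ Φ (a k)` with `a k` tending along `l`. -/
def outerLimit {α β : Type*} [TopologicalSpace β] (l : Filter α) (Φ : α → Set β) : Set β :=
  {y | ∃ (a : ℕ → α) (b : ℕ → β),
    Tendsto a atTop l ∧ (∀ k, b k ∈ Φ (a k)) ∧ Tendsto b atTop (𝓝 y)}

section Normals

variable {X : Type*} [NormedAddCommGroup X] [InnerProductSpace ℝ X]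

/-- The regular (Frechet) normal cone to `Ω` at `x`: the vectors `ξ` with
`⟪ξ, x' - x⟫ ≤ o(‖x' - x‖)` as `x' → x` in `Ω`; it is empty if `x ∉ Ω`. -/
def regularNormalCone (Ω : Set X) (x : X) : Set X :=
  {ξ | x ∈ Ω ∧ ∀ ε : ℝ, 0 < ε → ∀ᶠ x' in 𝓝[Ω] x, ⟪ξ, x' - x⟫ ≤ ε * ‖x' - x‖}

/-- The limiting (Mordukhovich) normal cone to `Ω` at `x`; it is empty if `x ∉ Ω`. -/
def limitingNormalCone (Ω : Set X) (x : X) : Set X :=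
  {ξ | x ∈ Ω ∧ ξ ∈ outerLimit (𝓝[Ω] x) (regularNormalCone Ω)}

/-- The epigraph of `f`, in the Euclidean (`ℓ²`) product `X × ℝ`. -/
def epigraph (f : X → EReal) : Set (WithLp 2 (X × ℝ)) :=
  {p | f p.fst ≤ ((p.snd : ℝ) : EReal)}

/-- The limiting (Mordukhovich) subdifferential of `f` at `x`; it is empty if `f x` is not finite. -/
def limitingSubdifferential (f : X → EReal) (x : X) : Set X :=
  {u | f x ≠ ⊤ ∧ f x ≠ ⊥ ∧
    WithLp.toLp 2 (u, (-1 : ℝ)) ∈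
      limitingNormalCone (epigraph f) (WithLp.toLp 2 (x, (f x).toReal))}

end Normals

section AtInfinity

variable {E G : Type*} [NormedAddCommGroup E] [InnerProductSpace ℝ E]
  [NormedAddCommGroup G] [InnerProductSpace ℝ G]

/-- The filter of `(x, y) → (∞, ybar)` within `Ω`: `‖x‖ → ∞`, `y → ybar`, `(x, y) ∈ Ω`. -/
def atInfinityWithin (Ω : Set (WithLp 2 (E × G))) (ybar : G) : Filter (WithLp 2 (E × G)) :=
  comap (fun p => ‖p.fst‖) atTop ⊓ comap (fun p => p.snd) (𝓝 ybar) ⊓ 𝓟 Ω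

/-- The normal cone to `Ω` at `(∞, ybar)`. -/
def normalConeAtInfinity (Ω : Set (WithLp 2 (E × G))) (ybar : G) : Set (WithLp 2 (E × G)) :=
  outerLimit (atInfinityWithin Ω ybar) (regularNormalCone Ω)

/-- The graph of a set-valued map, in the Euclidean (`ℓ²`) product `E × G`. -/
def graph (F : E → Set G) : Set (WithLp 2 (E × G)) :=
  {p | p.snd ∈ F p.fst}

/-- The inverse image `F⁻¹(V)`: the `x` for which `F x` meets `V`. -/
def inverseImage (F : E → Set G) (V : Set G) : Set E :=
  {x | (F x ∩ V).Nonempty}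

/-- The Jelonek set of `F`. -/
def jelonekSet (F : E → Set G) : Set G :=
  {y | ∃ (x : ℕ → E) (z : ℕ → G), (∀ k, z k ∈ F (x k)) ∧
    Tendsto (fun k => ‖x k‖) atTop atTop ∧ Tendsto z atTop (𝓝 y)}

/-- The coderivative of `F` at `(∞, ybar)`. -/
def coderivativeAtInfinity (F : E → Set G) (ybar : G) (v : G) : Set E :=
  {u | WithLp.toLp 2 (u, -v) ∈ normalConeAtInfinity (graph F) ybar}

/-- The distance function `d_F (x, y) = dist (y, F x)`, equal to `+∞` where `F x` is empty. -/
def distFun (F : E → Set G) (p : WithLp 2 (E × G)) : EReal :=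
  ((Metric.infEDist p.snd (F p.fst) : ENNReal) : EReal)

/-- `F` is Lipschitz-like at infinity with the data `R`, `ℓ`, `V`. -/
def LipschitzLikeAtInfinity (F : E → Set G) (R ℓ : ℝ) (V : Set G) : Prop :=
  ∀ x ∈ inverseImage F V \ Metric.closedBall 0 R,
    ∀ x' ∈ inverseImage F V \ Metric.closedBall 0 R,
      F x ∩ V ⊆ F x' + Metric.closedBall (0 : G) (ℓ * ‖x - x'‖)

/-- Every point of `gph F ∩ ((E \ closedBall 0 R) × V)` has a neighbourhood on which the distance
function is finite and Lipschitz with modulus `ℓ`, for the Euclidean norm of the product. -/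
def DistFunLocallyLipschitz (F : E → Set G) (R ℓ : ℝ) (V : Set G) : Prop :=
  ∀ p ∈ graph F, p.fst ∉ Metric.closedBall 0 R → p.snd ∈ V →
    ∃ U ∈ 𝓝 p, (∀ q ∈ U, distFun F q ≠ ⊤) ∧
      ∀ q ∈ U, ∀ q' ∈ U, |(distFun F q).toReal - (distFun F q').toReal| ≤ ℓ * ‖q - q'‖

/-- Limits of subgradients of the distance function at points of the graph tending to
`(∞, ybar)`. -/
def distSubgradientLimits (F : E → Set G) (ybar : G) : Set (WithLp 2 (E × G)) :=
  outerLimit (atInfinityWithin (graph F) ybar) (limitingSubdifferential (distFun F))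

/-- Limits of `r • w`, with `r` decreasing to `0` and `w` a subgradient of the distance function at
points of the graph tending to `(∞, ybar)`. -/
def distSingularLimits (F : E → Set G) (ybar : G) : Set (WithLp 2 (E × G)) :=
  outerLimit (atInfinityWithin (graph F) ybar ×ˢ 𝓝[>] (0 : ℝ))
    (fun q => q.2 • limitingSubdifferential (distFun F) q.1)

end AtInfinity

end VarAnal

end

namespace VarAnal

/-! ### Regular normals, Fréchet subgradients and Lipschitz bounds -/

section Normals

variable {X : Type*} [NormedAddCommGroup X] [InnerProductSpace ℝ X]

/-! The conditions are linked in the cycle (i) → (ii) → (iii) → (iv) → (i). (i) → (ii): compactness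
of the unit sphere of `E` turns (i) into a uniform bound `‖u‖ ≤ K * ‖v‖` for regular normals `(u,
-v)` near infinity (`exists_norm_fst_le_of_coderivativeAtInfinity`). To move from `(x₀, y₀)` in the
graph to a point over `x₁`, minimise over the closed graph the sum of `K * ‖x - x₁‖` and a smoothed
`‖y - y₀‖`. At a minimiser not lying over `x₁`, the negative gradient would be a regular normal with
first component of norm `K` and second of norm below 1, contradicting the bound
(`exists_mem_norm_sub_le_of_regularNormalCone`). (ii) → (iii): near-nearest points of `F x` are
carried to `F x'`. (iii) → (iv): the modulus bounds all subgradients, so multiples by scalars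
tending to 0 vanish. The same bound gives the final claim. (iv) → (i): a regular normal divided by
any `c > 0` with `c ≥ ‖ξ.snd‖` is a subgradient of `d_F`. If the second components tend to 0, such
`c` can serve as the scalars in (iv). -/

theorem zero_mem_regularNormalCone {Ω : Set X} {x : X} (hx : x ∈ Ω) :
    (0 : X) ∈ regularNormalCone Ω x := by
  refine ⟨hx, fun ε hε => Eventually.of_forall fun x' => ?_⟩
  rw [inner_zero_left]
  positivity

theorem smul_mem_regularNormalCone {Ω : Set X} {x ξ : X} (hξ : ξ ∈ regularNormalCone Ω x)
    {c : ℝ} (hc : 0 < c) : c • ξ ∈ regularNormalCone Ω x := by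
  refine ⟨hξ.1, fun ε hε => ?_⟩
  filter_upwards [hξ.2 (ε / c) (by positivity)] with x' hx'
  rw [real_inner_smul_left]
  calc c * ⟪ξ, x' - x⟫ ≤ c * (ε / c * ‖x' - x‖) := by gcongr
    _ = ε * ‖x' - x‖ := by field_simp

/-- A quadratic bound implies membership in the regular normal cone. -/
theorem mem_regularNormalCone_of_quadratic {Ω : Set X} {x ξ : X} (hx : x ∈ Ω) {C : ℝ}
    (hC : 0 < C) (h : ∀ x' ∈ Ω, ⟪ξ, x' - x⟫ ≤ C * ‖x' - x‖ ^ 2) : ξ ∈ regularNormalCone Ω x := by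
  refine ⟨hx, fun ε hε => ?_⟩
  filter_upwards [self_mem_nhdsWithin,
    mem_nhdsWithin_of_mem_nhds (Metric.ball_mem_nhds x (div_pos hε hC))] with x' hx' hb
  rw [Metric.mem_ball, dist_eq_norm, lt_div_iff₀ hC] at hb
  have := h x' hx'
  nlinarith [norm_nonneg (x' - x)]

/-- Regular normals make a nonpositive inner product with feasible directions. -/
theorem inner_nonpos_of_mem_regularNormalCone {Ω : Set X} {x ξ d : X}
    (hξ : ξ ∈ regularNormalCone Ω x) (hd : ∀ᶠ t : ℝ in 𝓝[>] 0, x + t • d ∈ Ω) :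
    ⟪ξ, d⟫ ≤ 0 := by
  have hlim : Tendsto (fun t : ℝ => x + t • d) (𝓝[>] 0) (𝓝[Ω] x) := by
    refine tendsto_nhdsWithin_iff.2 ⟨?_, hd⟩
    have : Tendsto (fun t : ℝ => x + t • d) (𝓝 0) (𝓝 (x + (0 : ℝ) • d)) :=
      Continuous.tendsto (by fun_prop) 0
    rw [zero_smul, add_zero] at this
    exact this.mono_left nhdsWithin_le_nhds
  have key : ∀ ε : ℝ, 0 < ε → ⟪ξ, d⟫ ≤ ε * ‖d‖ := by
    intro ε hε
    obtain ⟨t, ht, ht0⟩ := ((hlim.eventually (hξ.2 ε hε)).and self_mem_nhdsWithin).exists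
    have ht0 : 0 < t := ht0
    rw [add_sub_cancel_left, real_inner_smul_right, norm_smul, Real.norm_of_nonneg ht0.le] at ht
    nlinarith
  refine le_of_forall_pos_le_add fun δ hδ => ?_
  have h1 := key (δ / (‖d‖ + 1)) (by positivity)
  have h2 : δ / (‖d‖ + 1) * ‖d‖ ≤ δ := by
    rw [div_mul_eq_mul_div, div_le_iff₀ (by positivity)]
    nlinarith [norm_nonneg d]
  linarith

theorem regularNormalCone_subset_limitingNormalCone (Ω : Set X) (x : X) :
    regularNormalCone Ω x ⊆ limitingNormalCone Ω x := fun ξ hξ =>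
  ⟨hξ.1, fun _ => x, fun _ => ξ, tendsto_const_pure.mono_right (pure_le_nhdsWithin hξ.1),
    fun _ => hξ, tendsto_const_nhds⟩

/-- A Frechet subgradient is a limiting subgradient. -/
theorem mem_limitingSubdifferential_of_eventually {f : X → EReal} {x w : X} {c : ℝ}
    (hc : f x = c)
    (h : ∀ ε : ℝ, 0 < ε → ∀ᶠ x' in 𝓝 x, ((c + ⟪w, x' - x⟫ - ε * ‖x' - x‖ : ℝ) : EReal) ≤ f x') :
    w ∈ limitingSubdifferential f x := by
  refine ⟨by simp [hc], by simp [hc], regularNormalCone_subset_limitingNormalCone _ _ ⟨?_, ?_⟩⟩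
  · simp [epigraph, hc]
  intro ε hε
  have hfst : Tendsto (fun p : WithLp 2 (X × ℝ) => p.fst)
      (𝓝[epigraph f] (WithLp.toLp 2 (x, (f x).toReal))) (𝓝 x) := by
    have : Continuous (fun p : WithLp 2 (X × ℝ) => p.fst) := by fun_prop
    exact (this.tendsto (WithLp.toLp 2 (x, (f x).toReal))).mono_left nhdsWithin_le_nhds
  filter_upwards [hfst.eventually (h ε hε), self_mem_nhdsWithin] with p hp hpe
  have h1 : c + ⟪w, p.fst - x⟫ - ε * ‖p.fst - x‖ ≤ p.snd := by
    exact_mod_cast hp.trans hpe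
  have h2 : ‖p.fst - x‖ ≤ ‖p - WithLp.toLp 2 (x, (f x).toReal)‖ :=
    WithLp.norm_fst_le X (p - WithLp.toLp 2 (x, (f x).toReal))
  have h3 : ⟪WithLp.toLp 2 (w, (-1 : ℝ)), p - WithLp.toLp 2 (x, (f x).toReal)⟫ =
      ⟪w, p.fst - x⟫ - (p.snd - c) := by
    rw [WithLp.prod_inner_apply]
    simp [hc, sub_eq_add_neg]
  rw [h3]
  have h4 := mul_le_mul_of_nonneg_left h2 hε.le
  linarith

/-- Limiting subgradients of a locally Lipschitz function are bounded by its modulus. -/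
theorem norm_le_of_mem_limitingSubdifferential {f : X → EReal} {x w : X} {ℓ : ℝ} (hℓ : 0 ≤ ℓ)
    {U : Set X} (hU : U ∈ 𝓝 x) (htop : ∀ q ∈ U, f q ≠ ⊤) (hbot : ∀ q ∈ U, f q ≠ ⊥)
    (hlip : ∀ q ∈ U, ∀ q' ∈ U, |(f q).toReal - (f q').toReal| ≤ ℓ * ‖q - q'‖)
    (hw : w ∈ limitingSubdifferential f x) : ‖w‖ ≤ ℓ := by
  obtain ⟨-, -, -, a, b, ha, hb, hlim⟩ := hw
  have hcf : Continuous (fun p : WithLp 2 (X × ℝ) => p.fst) := by fun_prop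
  have hcs : Continuous (fun p : WithLp 2 (X × ℝ) => p.snd) := by fun_prop
  have haU : ∀ᶠ k in atTop, U ∈ 𝓝 (a k).fst := by
    have h1 : Tendsto (fun k => (a k).fst) atTop (𝓝 x) :=
      ((hcf.tendsto _).mono_left nhdsWithin_le_nhds).comp ha
    exact h1.eventually (eventually_mem_nhds_iff.2 hU)
  have key : ∀ᶠ k in atTop, ‖(b k).fst‖ ^ 2 + (b k).snd * (ℓ * ‖(b k).fst‖) ≤ 0 := by
    filter_upwards [haU] with k hk
    -- The Lipschitz bound makes this direction of slope `ℓ` feasible for the epigraph. With the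
    -- last component of the normal tending to -1, the limit reads `‖w‖ ^ 2 ≤ ℓ * ‖w‖`.
    have := inner_nonpos_of_mem_regularNormalCone (d := WithLp.toLp 2 ((b k).fst, ℓ * ‖(b k).fst‖))
      (hb k) ?_
    · rw [WithLp.prod_inner_apply] at this
      simpa [real_inner_self_eq_norm_sq, mul_comm] using this
    have hmove : Tendsto (fun t : ℝ => (a k).fst + t • (b k).fst) (𝓝[>] 0) (𝓝 (a k).fst) := by
      have : Tendsto (fun t : ℝ => (a k).fst + t • (b k).fst) (𝓝 0)
          (𝓝 ((a k).fst + (0 : ℝ) • (b k).fst)) := Continuous.tendsto (by fun_prop) 0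
      rw [zero_smul, add_zero] at this
      exact this.mono_left nhdsWithin_le_nhds
    filter_upwards [hmove hk, self_mem_nhdsWithin] with t ht ht0
    have ht0 : 0 < t := ht0
    have hz : (a k).fst ∈ U := mem_of_mem_nhds hk
    have ht : (a k).fst + t • (b k).fst ∈ U := ht
    have hle := (abs_le.1 (hlip _ ht _ hz)).2
    rw [add_sub_cancel_left, norm_smul, Real.norm_of_nonneg ht0.le] at hle
    have hak : f (a k).fst ≤ ((a k).snd : ℝ) := (hb k).1
    rw [← EReal.coe_toReal (htop _ hz) (hbot _ hz), EReal.coe_le_coe_iff] at hak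
    change f ((a k).fst + t • (b k).fst) ≤ (((a k).snd + t * (ℓ * ‖(b k).fst‖) : ℝ) : EReal)
    rw [← EReal.coe_toReal (htop _ ht) (hbot _ ht), EReal.coe_le_coe_iff]
    linarith
  have hf : Tendsto (fun k => (b k).fst) atTop (𝓝 w) := (hcf.tendsto _).comp hlim
  have hs : Tendsto (fun k => (b k).snd) atTop (𝓝 (-1)) := (hcs.tendsto _).comp hlim
  have := le_of_tendsto ((hf.norm.pow 2).add (hs.mul (hf.norm.const_mul ℓ))) key
  by_contra! hcon
  nlinarith [norm_nonneg w]

/-- The concavity estimate for `√(‖·‖² + η)`. -/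
theorem sqrt_norm_sq_add_le (a b : X) {η : ℝ} (hη : 0 ≤ η) (hc : 0 < √(‖a‖ ^ 2 + η)) :
    √(‖b‖ ^ 2 + η) ≤ √(‖a‖ ^ 2 + η) + ⟪(√(‖a‖ ^ 2 + η))⁻¹ • a, b - a⟫ +
      (2 * √(‖a‖ ^ 2 + η))⁻¹ * ‖b - a‖ ^ 2 := by
  have h1 : √(‖a‖ ^ 2 + η) ^ 2 = ‖a‖ ^ 2 + η := Real.sq_sqrt (by positivity)
  have h2 : √(‖b‖ ^ 2 + η) ^ 2 = ‖b‖ ^ 2 + η := Real.sq_sqrt (by positivity)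
  have h3 : ‖b‖ ^ 2 = ‖a‖ ^ 2 + 2 * ⟪a, b - a⟫ + ‖b - a‖ ^ 2 := by
    rw [← norm_add_sq_real, add_sub_cancel]
  set c := √(‖a‖ ^ 2 + η)
  set s := √(‖b‖ ^ 2 + η)
  rw [real_inner_smul_left]
  -- The right side is an exact rearrangement, so the claim is `2 * c * s ≤ c ^ 2 + s ^ 2`.
  have h4 : c + c⁻¹ * ⟪a, b - a⟫ + (2 * c)⁻¹ * ‖b - a‖ ^ 2 = (c ^ 2 + s ^ 2) / (2 * c) := by
    rw [h2, h3]
    field_simp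
    linarith
  rw [h4, le_div_iff₀ (by positivity)]
  nlinarith [sq_nonneg (s - c)]

end Normals

/-! ### The distance function as an infimum over values -/

section DistFun

variable {E G : Type*} [NormedAddCommGroup G]

theorem distFun_ne_bot (F : E → Set G) (p : WithLp 2 (E × G)) : distFun F p ≠ ⊥ :=
  EReal.coe_ennreal_ne_bot _

theorem distFun_eq_zero {F : E → Set G} {p : WithLp 2 (E × G)} (hp : p ∈ graph F) :
    distFun F p = 0 := by
  have : Metric.infEDist p.snd (F p.fst) = 0 := Metric.infEDist_zero_of_mem hp
  simp [distFun, this]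

theorem coe_le_distFun {F : E → Set G} {p : WithLp 2 (E × G)} {s : ℝ}
    (h : ∀ v ∈ F p.fst, s ≤ ‖p.snd - v‖) : (s : EReal) ≤ distFun F p := by
  have h1 : ENNReal.ofReal s ≤ Metric.infEDist p.snd (F p.fst) := by
    refine Metric.le_infEDist.2 fun v hv => ?_
    rw [edist_dist, dist_eq_norm]
    exact ENNReal.ofReal_le_ofReal (h v hv)
  calc (s : EReal) ≤ ((ENNReal.ofReal s : ENNReal) : EReal) := by
        rw [EReal.coe_ennreal_ofReal]
        exact_mod_cast le_max_left _ _
    _ ≤ distFun F p := EReal.coe_ennreal_le_coe_ennreal_iff.2 h1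

theorem exists_mem_norm_sub_lt {F : E → Set G} {p : WithLp 2 (E × G)} (hp : distFun F p ≠ ⊤)
    {η : ℝ} (hη : 0 < η) : ∃ v ∈ F p.fst, ‖p.snd - v‖ < (distFun F p).toReal + η := by
  by_contra! hcon
  have h1 := coe_le_distFun hcon
  rw [← EReal.coe_toReal hp (distFun_ne_bot F p), EReal.coe_le_coe_iff, EReal.toReal_coe] at h1
  linarith

theorem distFun_le_of_mem {F : E → Set G} {p : WithLp 2 (E × G)} {v : G} (hv : v ∈ F p.fst) :
    distFun F p ≤ (‖p.snd - v‖ : ℝ) := by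
  have h1 : Metric.infEDist p.snd (F p.fst) ≤ ENNReal.ofReal ‖p.snd - v‖ := by
    rw [← dist_eq_norm, ← edist_dist]
    exact Metric.infEDist_le_edist_of_mem hv
  calc distFun F p ≤ ((ENNReal.ofReal ‖p.snd - v‖ : ENNReal) : EReal) :=
        EReal.coe_ennreal_le_coe_ennreal_iff.2 h1
    _ = (‖p.snd - v‖ : ℝ) := by rw [EReal.coe_ennreal_ofReal, max_eq_left (norm_nonneg _)]

theorem distFun_toReal_le_of_mem {F : E → Set G} {p : WithLp 2 (E × G)} {v : G}
    (hv : v ∈ F p.fst) : (distFun F p).toReal ≤ ‖p.snd - v‖ := by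
  have h := distFun_le_of_mem hv
  have htop : distFun F p ≠ ⊤ := ne_top_of_le_ne_top (EReal.coe_ne_top _) h
  rwa [← EReal.coe_toReal htop (distFun_ne_bot F p), EReal.coe_le_coe_iff] at h

end DistFun

/-! ### From the Lipschitz-like property to the distance function -/

section Normed

variable {E G : Type*} [NormedAddCommGroup E] [NormedAddCommGroup G]

theorem norm_le_norm_fst_add_norm_snd (p : WithLp 2 (E × G)) : ‖p‖ ≤ ‖p.fst‖ + ‖p.snd‖ := by
  refine abs_le_of_sq_le_sq' ?_ (by positivity) |>.2
  rw [WithLp.prod_norm_sq_eq_of_L2]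
  nlinarith [mul_nonneg (norm_nonneg p.fst) (norm_nonneg p.snd)]

theorem tendsto_atInfinityWithin_iff {ι : Type*} {l : Filter ι} {Ω : Set (WithLp 2 (E × G))}
    {ybar : G} {a : ι → WithLp 2 (E × G)} :
    Tendsto a l (atInfinityWithin Ω ybar) ↔ Tendsto (fun k => ‖(a k).fst‖) l atTop ∧
      Tendsto (fun k => (a k).snd) l (𝓝 ybar) ∧ ∀ᶠ k in l, a k ∈ Ω := by
  simp only [atInfinityWithin, tendsto_inf, tendsto_comap_iff, tendsto_principal, and_assoc]
  rfl

theorem exists_tendsto_atInfinityWithin {F : E → Set G} {ybar : G} (hy : ybar ∈ jelonekSet F) :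
    ∃ a : ℕ → WithLp 2 (E × G), Tendsto a atTop (atInfinityWithin (graph F) ybar) ∧
      ∀ k, a k ∈ graph F := by
  obtain ⟨x, z, hz, hx, hlim⟩ := hy
  exact ⟨fun k => WithLp.toLp 2 (x k, z k),
    tendsto_atInfinityWithin_iff.2 ⟨hx, hlim, Eventually.of_forall hz⟩, hz⟩

theorem LipschitzLikeAtInfinity.exists_mem {F : E → Set G} {R ℓ : ℝ} {V : Set G}
    (h : LipschitzLikeAtInfinity F R ℓ V) {x x' : E}
    (hx : x ∈ inverseImage F V \ Metric.closedBall 0 R)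
    (hx' : x' ∈ inverseImage F V \ Metric.closedBall 0 R) {y : G} (hy : y ∈ F x) (hyV : y ∈ V) :
    ∃ y' ∈ F x', ‖y - y'‖ ≤ ℓ * ‖x - x'‖ := by
  obtain ⟨y', hy', z, hz, hyz⟩ := Set.mem_add.1 (h x hx x' hx' ⟨hy, hyV⟩)
  refine ⟨y', hy', ?_⟩
  rw [← hyz, add_sub_cancel_left]
  simpa using hz

/-- A nearly nearest point `v` of `F q.fst` lies in `V` when `q` is close to `p`, hence has a
partner in `F q'.fst`. Moving the base point costs `ℓ` and moving the second coordinate costs 1,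
whence `1 + ℓ`. -/
theorem LipschitzLikeAtInfinity.distFunLocallyLipschitz {F : E → Set G} {R ℓ : ℝ} (hℓ : 0 < ℓ)
    {V : Set G} (hV : IsOpen V) (hO : IsOpen (inverseImage F V \ Metric.closedBall 0 R))
    (h : LipschitzLikeAtInfinity F R ℓ V) : DistFunLocallyLipschitz F R (1 + ℓ) V := by
  intro p hp hpR hpV
  have hpO : p.fst ∈ inverseImage F V \ Metric.closedBall 0 R := ⟨⟨p.snd, hp, hpV⟩, hpR⟩
  obtain ⟨r, hr, hrO⟩ := Metric.isOpen_iff.1 hO _ hpO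
  obtain ⟨δ, hδ, hδV⟩ := Metric.isOpen_iff.1 hV _ hpV
  -- Near-nearest points lie within `ρ + (1 + ℓ) * ρ + δ / 2` of `p.snd`; this radius keeps the sum
  -- at most `δ`.
  set ρ : ℝ := min r (δ / (2 * (2 + ℓ))) with hρ
  have hρ0 : 0 < ρ := lt_min hr (by positivity)
  have hρδ : (2 + ℓ) * ρ ≤ δ / 2 := by
    calc (2 + ℓ) * ρ ≤ (2 + ℓ) * (δ / (2 * (2 + ℓ))) := by gcongr; exact min_le_right _ _
      _ = δ / 2 := by field_simp
  have hfst : ∀ q ∈ Metric.ball p ρ, ‖q.fst - p.fst‖ < ρ := fun q hq =>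
    (WithLp.norm_fst_le E (q - p)).trans_lt (by simpa [dist_eq_norm] using hq)
  have hsnd : ∀ q ∈ Metric.ball p ρ, ‖q.snd - p.snd‖ < ρ := fun q hq =>
    (WithLp.norm_snd_le E (q - p)).trans_lt (by simpa [dist_eq_norm] using hq)
  have hqO : ∀ q ∈ Metric.ball p ρ, q.fst ∈ inverseImage F V \ Metric.closedBall 0 R :=
    fun q hq => hrO (by
      rw [Metric.mem_ball, dist_eq_norm]
      exact (hfst q hq).trans_le (min_le_left _ _))
  have hsmall : ∀ q ∈ Metric.ball p ρ,
      distFun F q ≠ ⊤ ∧ (distFun F q).toReal ≤ (1 + ℓ) * ρ := by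
    intro q hq
    obtain ⟨v, hv, hpv⟩ := h.exists_mem hpO (hqO q hq) hp hpV
    refine ⟨ne_top_of_le_ne_top (EReal.coe_ne_top _) (distFun_le_of_mem hv),
      (distFun_toReal_le_of_mem hv).trans ?_⟩
    have h1 := norm_sub_le_norm_sub_add_norm_sub q.snd p.snd v
    have h2 := hsnd q hq
    have h3 := hfst q hq
    rw [norm_sub_rev] at h3
    nlinarith
  have hone : ∀ q ∈ Metric.ball p ρ, ∀ q' ∈ Metric.ball p ρ,
      (distFun F q').toReal ≤ (distFun F q).toReal + (1 + ℓ) * ‖q - q'‖ := by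
    intro q hq q' hq'
    refine le_of_forall_pos_le_add fun η hη => ?_
    obtain ⟨v, hv, hqv⟩ := exists_mem_norm_sub_lt (hsmall q hq).1 (lt_min hη (half_pos hδ))
    have hvV : v ∈ V := hδV (by
      rw [Metric.mem_ball, dist_eq_norm]
      have h1 := norm_sub_le_norm_sub_add_norm_sub v q.snd p.snd
      rw [norm_sub_rev v q.snd] at h1
      have h2 := hsnd q hq
      have h3 := (hsmall q hq).2
      have h4 := min_le_right η (δ / 2)
      nlinarith)
    obtain ⟨v', hv', hvv⟩ := h.exists_mem (hqO q hq) (hqO q' hq') hv hvV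
    have h1 := distFun_toReal_le_of_mem hv'
    have h2 := norm_sub_le_norm_sub_add_norm_sub q'.snd q.snd v'
    have h3 := norm_sub_le_norm_sub_add_norm_sub q.snd v v'
    have h4 : ‖q.fst - q'.fst‖ ≤ ‖q - q'‖ := WithLp.norm_fst_le E (q - q')
    have h5 : ‖q.snd - q'.snd‖ ≤ ‖q - q'‖ := WithLp.norm_snd_le E (q - q')
    rw [norm_sub_rev] at h5
    have h6 := min_le_left η (δ / 2)
    nlinarith
  refine ⟨Metric.ball p ρ, Metric.ball_mem_nhds p hρ0, fun q hq => (hsmall q hq).1,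
    fun q hq q' hq' => abs_sub_le_iff.2 ⟨?_, ?_⟩⟩
  · have := hone q' hq' q hq
    rw [norm_sub_rev] at this
    linarith
  · have := hone q hq q' hq'
    linarith

end Normed

/-! ### Subgradients of the distance function along the graph -/

section AtInfinity

variable {E G : Type*} [NormedAddCommGroup E] [InnerProductSpace ℝ E]
  [NormedAddCommGroup G] [InnerProductSpace ℝ G]

/-- A regular normal to the graph is a multiple of a subgradient of the distance function. -/
theorem inv_smul_mem_limitingSubdifferential_distFun {F : E → Set G} {p ξ : WithLp 2 (E × G)}
    (hξ : ξ ∈ regularNormalCone (graph F) p) {c : ℝ} (hc : 0 < c) (hξc : ‖ξ.snd‖ ≤ c) :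
    c⁻¹ • ξ ∈ limitingSubdifferential (distFun F) p := by
  refine mem_limitingSubdifferential_of_eventually (c := 0)
    (by simpa using distFun_eq_zero hξ.1) fun ε hε => ?_
  -- Threshold between two cases: if `v` is at least `C * ‖q - p‖` away from `q.snd`, Cauchy–Schwarz
  -- suffices. Otherwise `(q.fst, v)` is a graph point within `(1 + C) * ‖q - p‖` of `p`, and the
  -- normal inequality applies there.
  set C : ℝ := ‖ξ‖ / c with hC
  have hC0 : 0 ≤ C := by positivity
  have hev := hξ.2 (c * ε / (1 + C)) (by positivity)
  rw [eventually_nhdsWithin_iff, Metric.eventually_nhds_iff] at hev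
  obtain ⟨δ, hδ, hev⟩ := hev
  filter_upwards [Metric.ball_mem_nhds p (show 0 < δ / (1 + C) by positivity)] with q hq
  rw [Metric.mem_ball, dist_eq_norm, lt_div_iff₀ (by positivity)] at hq
  refine coe_le_distFun fun v hv => ?_
  rw [real_inner_smul_left]
  suffices h : ⟪ξ, q - p⟫ - c * (ε * ‖q - p‖) ≤ c * ‖q.snd - v‖ by
    have h' : c⁻¹ * (⟪ξ, q - p⟫ - c * (ε * ‖q - p‖)) ≤ ‖q.snd - v‖ := by
      rwa [inv_mul_le_iff₀ hc]
    have h'' : c⁻¹ * (⟪ξ, q - p⟫ - c * (ε * ‖q - p‖)) = c⁻¹ * ⟪ξ, q - p⟫ - ε * ‖q - p‖ := by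
      field_simp
    linarith
  rcases le_or_gt (C * ‖q - p‖) ‖q.snd - v‖ with hfar | hnear
  · have h1 : ⟪ξ, q - p⟫ ≤ ‖ξ‖ * ‖q - p‖ := real_inner_le_norm _ _
    have h2 : ‖ξ‖ = c * C := by rw [hC]; field_simp
    have h3 : 0 ≤ c * (ε * ‖q - p‖) := by positivity
    rw [h2] at h1
    nlinarith
  · set q' : WithLp 2 (E × G) := WithLp.toLp 2 (q.fst, v) with hq'
    have hdiff : ‖q' - q‖ ≤ ‖q.snd - v‖ := by
      have := norm_le_norm_fst_add_norm_snd (q' - q)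
      have h1 : (q' - q).fst = 0 := by simp [hq']
      have h2 : (q' - q).snd = v - q.snd := by simp [hq']
      rwa [h1, h2, norm_zero, zero_add, norm_sub_rev v] at this
    have hq'p : ‖q' - p‖ ≤ (1 + C) * ‖q - p‖ := by
      have : ‖q' - p‖ ≤ ‖q' - q‖ + ‖q - p‖ := by
        simpa using norm_add_le (q' - q) (q - p)
      linarith
    have h1 := hev (y := q') (by rw [dist_eq_norm]; linarith) hv
    have h2 : c * ε / (1 + C) * ‖q' - p‖ ≤ c * ε * ‖q - p‖ := by
      calc c * ε / (1 + C) * ‖q' - p‖ ≤ c * ε / (1 + C) * ((1 + C) * ‖q - p‖) := by gcongr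
        _ = c * ε * ‖q - p‖ := by field_simp
    have h3 : ⟪ξ, q - p⟫ = ⟪ξ, q' - p⟫ + ⟪ξ, q - q'⟫ := by
      rw [← inner_add_right]; congr 1; abel
    have h4 : ⟪ξ, q - q'⟫ = ⟪ξ.snd, q.snd - v⟫ := by
      rw [WithLp.prod_inner_apply]
      simp [hq']
    have h5 : ⟪ξ.snd, q.snd - v⟫ ≤ c * ‖q.snd - v‖ :=
      (real_inner_le_norm _ _).trans (by gcongr)
    linarith

theorem zero_mem_coderivativeAtInfinity {F : E → Set G} {ybar : G} (hy : ybar ∈ jelonekSet F) :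
    (0 : E) ∈ coderivativeAtInfinity F ybar 0 := by
  obtain ⟨a, ha, hag⟩ := exists_tendsto_atInfinityWithin hy
  refine ⟨a, fun _ => 0, ha, fun k => zero_mem_regularNormalCone (hag k), ?_⟩
  have : WithLp.toLp 2 ((0 : E), -(0 : G)) = 0 := by rw [neg_zero]; rfl
  rw [this]
  exact tendsto_const_nhds

theorem zero_mem_distSingularLimits {F : E → Set G} {ybar : G} (hy : ybar ∈ jelonekSet F) :
    (0 : WithLp 2 (E × G)) ∈ distSingularLimits F ybar := by
  obtain ⟨a, ha, hag⟩ := exists_tendsto_atInfinityWithin hy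
  refine ⟨fun k => (a k, 1 / ((k : ℝ) + 1)), fun _ => 0, ha.prodMk ?_, fun k => ?_,
    tendsto_const_nhds⟩
  · exact tendsto_nhdsWithin_iff.2 ⟨tendsto_one_div_add_atTop_nhds_zero_nat,
      Eventually.of_forall fun k => Set.mem_Ioi.2 Nat.one_div_pos_of_nat⟩
  · have := inv_smul_mem_limitingSubdifferential_distFun
      (zero_mem_regularNormalCone (hag k)) one_pos (by simp)
    exact Set.mem_smul_set.2 ⟨_, this, by simp⟩

theorem norm_le_of_distFunLocallyLipschitz {F : E → Set G} {R ℓ : ℝ} (hℓ : 0 ≤ ℓ) {V : Set G}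
    (h : DistFunLocallyLipschitz F R ℓ V) {p w : WithLp 2 (E × G)} (hp : p ∈ graph F)
    (hpR : R < ‖p.fst‖) (hpV : p.snd ∈ V) (hw : w ∈ limitingSubdifferential (distFun F) p) :
    ‖w‖ ≤ ℓ := by
  obtain ⟨U, hU, htop, hlip⟩ := h p hp (by simpa using hpR) hpV
  exact norm_le_of_mem_limitingSubdifferential hℓ hU htop (fun q _ => distFun_ne_bot F q) hlip hw

theorem eventually_norm_le_of_distFunLocallyLipschitz {F : E → Set G} {R ℓ : ℝ} (hℓ : 0 ≤ ℓ)
    {V : Set G} {ybar : G} (hV : V ∈ 𝓝 ybar) (h : DistFunLocallyLipschitz F R ℓ V) :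
    ∀ᶠ p in atInfinityWithin (graph F) ybar,
      ∀ w ∈ limitingSubdifferential (distFun F) p, ‖w‖ ≤ ℓ := by
  obtain ⟨h1, h2, h3⟩ := tendsto_atInfinityWithin_iff.1
    (tendsto_id (x := atInfinityWithin (graph F) ybar))
  filter_upwards [h1.eventually_gt_atTop R, h2 hV, h3] with p hR hpV hp w hw
  exact norm_le_of_distFunLocallyLipschitz hℓ h hp hR hpV hw

theorem norm_le_of_mem_distSubgradientLimits {F : E → Set G} {R ℓ : ℝ} (hℓ : 0 ≤ ℓ)
    {V : Set G} {ybar : G} (hV : V ∈ 𝓝 ybar) (h : DistFunLocallyLipschitz F R ℓ V)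
    {w : WithLp 2 (E × G)} (hw : w ∈ distSubgradientLimits F ybar) : ‖w‖ ≤ ℓ := by
  obtain ⟨a, b, ha, hb, hlim⟩ := hw
  refine le_of_tendsto hlim.norm ?_
  filter_upwards [ha.eventually (eventually_norm_le_of_distFunLocallyLipschitz hℓ hV h)]
    with k hk using hk _ (hb k)

theorem distSingularLimits_eq_zero {F : E → Set G} {R ℓ : ℝ} (hℓ : 0 ≤ ℓ)
    {V : Set G} {ybar : G} (hy : ybar ∈ jelonekSet F) (hV : V ∈ 𝓝 ybar)
    (h : DistFunLocallyLipschitz F R ℓ V) : distSingularLimits F ybar = {0} := by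
  refine Set.Subset.antisymm ?_ (Set.singleton_subset_iff.2 (zero_mem_distSingularLimits hy))
  rintro w ⟨a, b, ha, hb, hlim⟩
  have h1 : Tendsto (fun k => (a k).1) atTop (atInfinityWithin (graph F) ybar) :=
    tendsto_fst.comp ha
  have h2 : Tendsto (fun k => (a k).2) atTop (𝓝[>] 0) := tendsto_snd.comp ha
  have h3 := tendsto_nhdsWithin_iff.1 h2
  refine tendsto_nhds_unique hlim (squeeze_zero_norm' (a := fun k => (a k).2 * ℓ) ?_ ?_)
  · filter_upwards [h1.eventually (eventually_norm_le_of_distFunLocallyLipschitz hℓ hV h), h3.2]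
      with k hk hpos
    have hpos : 0 < (a k).2 := hpos
    obtain ⟨w', hw', hbw⟩ := Set.mem_smul_set.1 (hb k)
    rw [← hbw, norm_smul, Real.norm_of_nonneg hpos.le]
    exact mul_le_mul_of_nonneg_left (hk _ hw') hpos.le
  · simpa using h3.1.mul_const ℓ

theorem coderivativeAtInfinity_eq_zero_of_distSingularLimits {F : E → Set G} {ybar : G}
    (hy : ybar ∈ jelonekSet F) (h : distSingularLimits F ybar = {0}) :
    coderivativeAtInfinity F ybar 0 = {0} := by
  refine Set.Subset.antisymm ?_ (Set.singleton_subset_iff.2 (zero_mem_coderivativeAtInfinity hy))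
  rintro u ⟨a, b, ha, hb, hlim⟩
  have hcs : Continuous (fun p : WithLp 2 (E × G) => p.snd) := by fun_prop
  have hs : Tendsto (fun k => ‖(b k).snd‖) atTop (𝓝 0) := by
    have : Tendsto (fun k => (b k).snd) atTop (𝓝 (-0)) := (hcs.tendsto _).comp hlim
    simpa using this.norm
  have hmem : WithLp.toLp 2 (u, -(0 : G)) ∈ distSingularLimits F ybar := by
    -- The added `1 / (k + 1)` keeps the multiplier positive even when the second component
    -- vanishes.
    refine ⟨fun k => (a k, ‖(b k).snd‖ + 1 / ((k : ℝ) + 1)), b, ha.prodMk ?_, fun k => ?_, hlim⟩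
    · refine tendsto_nhdsWithin_iff.2 ⟨?_, Eventually.of_forall fun k => ?_⟩
      · simpa using hs.add (tendsto_one_div_add_atTop_nhds_zero_nat (𝕜 := ℝ))
      · exact add_pos_of_nonneg_of_pos (norm_nonneg _) Nat.one_div_pos_of_nat
    · have hpos : 0 < ‖(b k).snd‖ + 1 / ((k : ℝ) + 1) :=
        add_pos_of_nonneg_of_pos (norm_nonneg _) Nat.one_div_pos_of_nat
      have := inv_smul_mem_limitingSubdifferential_distFun (hb k) hpos
        (le_add_of_nonneg_right Nat.one_div_pos_of_nat.le)
      exact Set.mem_smul_set.2 ⟨_, this, smul_inv_smul₀ hpos.ne' _⟩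
  rw [h] at hmem
  have := congrArg (fun p : WithLp 2 (E × G) => p.fst) (Set.mem_singleton_iff.1 hmem)
  simpa using this

/-! ### From the coderivative to the Lipschitz-like property -/

section FiniteDimensional

variable [FiniteDimensional ℝ E]

/-- If the coderivative at infinity is trivial at `0`, regular normals `(u, -v)` to the graph near
infinity satisfy `‖u‖ ≤ K * ‖v‖` uniformly. -/
theorem exists_norm_fst_le_of_coderivativeAtInfinity {F : E → Set G} {ybar : G}
    (h : coderivativeAtInfinity F ybar 0 ⊆ {0}) :
    ∃ K : ℝ, 0 < K ∧ ∃ R : ℝ, 0 < R ∧ ∃ δ : ℝ, 0 < δ ∧ ∀ p : WithLp 2 (E × G), R < ‖p.fst‖ →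
      ‖p.snd - ybar‖ < δ → ∀ ξ ∈ regularNormalCone (graph F) p, ‖ξ.fst‖ ≤ K * ‖ξ.snd‖ := by
  by_contra! hcon
  have hk : ∀ k : ℕ, (0 : ℝ) < (k : ℝ) + 1 := fun k => Nat.cast_add_one_pos k
  choose p hpR hpδ ξ hξ hlt using fun k : ℕ =>
    hcon ((k : ℝ) + 1) (hk k) ((k : ℝ) + 1) (hk k) (1 / ((k : ℝ) + 1)) (one_div_pos.2 (hk k))
  have hpos : ∀ k, 0 < ‖(ξ k).fst‖ := fun k =>
    (mul_nonneg (hk k).le (norm_nonneg _)).trans_lt (hlt k)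
  -- Normalising by the first component puts it on the unit sphere of `E` and forces the second to
  -- 0, so compactness is needed only in `E`.
  set ζ : ℕ → WithLp 2 (E × G) := fun k => ‖(ξ k).fst‖⁻¹ • ξ k with hζ
  have hζ1 : ∀ k, (ζ k).fst ∈ Metric.sphere (0 : E) 1 := by
    intro k
    have : (ζ k).fst = ‖(ξ k).fst‖⁻¹ • (ξ k).fst := rfl
    rw [mem_sphere_zero_iff_norm, this, norm_smul, norm_inv, norm_norm,
      inv_mul_cancel₀ (hpos k).ne']
  have hζ2 : ∀ k, ‖(ζ k).snd‖ ≤ 1 / ((k : ℝ) + 1) := by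
    intro k
    have : (ζ k).snd = ‖(ξ k).fst‖⁻¹ • (ξ k).snd := rfl
    rw [this, norm_smul, norm_inv, norm_norm, inv_mul_le_iff₀ (hpos k), mul_one_div,
      le_div_iff₀ (hk k)]
    linarith [hlt k]
  obtain ⟨u, hu, φ, hφ, hlim⟩ := (isCompact_sphere (0 : E) 1).tendsto_subseq hζ1
  have hdecay : Tendsto (fun k : ℕ => 1 / ((φ k : ℝ) + 1)) atTop (𝓝 0) :=
    (tendsto_one_div_add_atTop_nhds_zero_nat (𝕜 := ℝ)).comp hφ.tendsto_atTop
  have hlim2 : Tendsto (fun k => (ζ (φ k)).snd) atTop (𝓝 (-0)) := by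
    rw [neg_zero]
    exact squeeze_zero_norm (fun k => hζ2 (φ k)) hdecay
  have hu0 : u ∈ coderivativeAtInfinity F ybar 0 := by
    refine ⟨p ∘ φ, ζ ∘ φ, tendsto_atInfinityWithin_iff.2 ⟨?_, ?_, ?_⟩, fun k =>
      smul_mem_regularNormalCone (hξ _) (inv_pos.2 (hpos _)), ?_⟩
    · refine tendsto_atTop_mono (fun k => ?_)
        ((tendsto_natCast_atTop_atTop (R := ℝ)).comp hφ.tendsto_atTop)
      have := hpR (φ k)
      simp only [Function.comp_apply]
      linarith
    · exact tendsto_iff_norm_sub_tendsto_zero.2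
        (squeeze_zero (fun _ => norm_nonneg _) (fun k => (hpδ (φ k)).le) hdecay)
    · exact Eventually.of_forall fun k => (hξ (φ k)).1
    · exact ((WithLp.prod_continuous_toLp 2 E G).tendsto (u, -0)).comp (hlim.prodMk_nhds hlim2)
  have hu00 : u = 0 := h hu0
  rw [hu00] at hu
  simp at hu

variable [FiniteDimensional ℝ G]

/-- A uniform bound on the regular normals to a closed graph gives a Lipschitz estimate for `F`. -/
theorem exists_mem_norm_sub_le_of_regularNormalCone {F : E → Set G} (hF : IsClosed (graph F))
    {K R δ : ℝ} (hK : 0 < K) {ybar : G}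
    (hN : ∀ p : WithLp 2 (E × G), R < ‖p.fst‖ → ‖p.snd - ybar‖ < δ →
      ∀ ξ ∈ regularNormalCone (graph F) p, ‖ξ.fst‖ ≤ K * ‖ξ.snd‖)
    {x₀ x₁ : E} {y₀ : G} (hy₀ : y₀ ∈ F x₀) (hx : R + 2 * ‖x₀ - x₁‖ < ‖x₀‖)
    (hy : ‖y₀ - ybar‖ + 2 * K * ‖x₀ - x₁‖ < δ) :
    ∃ y₁ ∈ F x₁, ‖y₀ - y₁‖ ≤ 2 * K * ‖x₀ - x₁‖ := by
  rcases eq_or_ne x₀ x₁ with rfl | hne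
  · exact ⟨y₀, hy₀, by simp⟩
  set D := ‖x₀ - x₁‖ with hD
  have hD0 : 0 < D := norm_pos_iff.2 (sub_ne_zero.2 hne)
  set ε := K * D with hε
  have hε0 : 0 < ε := by positivity
  -- The smoothing `ε = K * D` doubles the starting value to `2 * ε`. Since the root is at least
  -- `ε`, the sublevel set stays within `D` of `x₁` and `2 * ε` of `y₀`.
  set f : WithLp 2 (E × G) → ℝ :=
    fun p => K * ‖p.fst - x₁‖ + √(‖p.snd - y₀‖ ^ 2 + ε ^ 2) with hf
  have hfc : Continuous f := by fun_prop
  have hsq : ∀ p : WithLp 2 (E × G), ε ≤ √(‖p.snd - y₀‖ ^ 2 + ε ^ 2) := fun p =>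
    Real.le_sqrt_of_sq_le (by nlinarith [sq_nonneg ‖p.snd - y₀‖])
  have hsq' : ∀ p : WithLp 2 (E × G), ‖p.snd - y₀‖ ≤ √(‖p.snd - y₀‖ ^ 2 + ε ^ 2) := fun p =>
    Real.le_sqrt_of_sq_le (by nlinarith)
  have hf0 : f (WithLp.toLp 2 (x₀, y₀)) = 2 * ε := by
    change K * ‖x₀ - x₁‖ + √(‖y₀ - y₀‖ ^ 2 + ε ^ 2) = 2 * ε
    rw [sub_self, norm_zero, zero_pow two_ne_zero, zero_add, Real.sqrt_sq hε0.le, two_mul]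
  have hloc : ∀ p, f p ≤ 2 * ε → ‖p.fst - x₁‖ ≤ D ∧ ‖p.snd - y₀‖ ≤ 2 * ε := by
    intro p hp
    have h1 := hsq p
    have h2 := hsq' p
    simp only [hf] at hp
    refine ⟨le_of_mul_le_mul_left (by linarith) hK, ?_⟩
    nlinarith [norm_nonneg (p.fst - x₁)]
  obtain ⟨p, hp, hmin⟩ := hfc.continuousOn.exists_isMinOn' (s := graph F)
      (x₀ := WithLp.toLp 2 (x₀, y₀)) hF hy₀ (by
    refine Filter.Eventually.filter_mono inf_le_left ?_
    filter_upwards [(tendsto_norm_cocompact_atTop (E := WithLp 2 (E × G))).eventually_gt_atTop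
      (D + ‖x₁‖ + (2 * ε + ‖y₀‖))] with q hq
    rw [hf0]
    by_contra! hcon
    obtain ⟨h1, h2⟩ := hloc q hcon.le
    have h3 := norm_le_norm_fst_add_norm_snd q
    have h4 := norm_le_norm_sub_add q.fst x₁
    have h5 := norm_le_norm_sub_add q.snd y₀
    linarith)
  have hple : f p ≤ 2 * ε := hf0 ▸ hmin hy₀
  obtain ⟨hp1, hp2⟩ := hloc p hple
  by_cases hpx : p.fst = x₁
  · refine ⟨p.snd, hpx ▸ hp, ?_⟩
    rw [norm_sub_rev]
    linarith
  exfalso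
  -- The `+ 0` lets `sqrt_norm_sq_add_le` apply with `η = 0`, the norm being smooth away from `x₁`.
  set c := √(‖p.fst - x₁‖ ^ 2 + 0) with hc
  have hcn : c = ‖p.fst - x₁‖ := by rw [hc, add_zero, Real.sqrt_sq (norm_nonneg _)]
  have hc0 : 0 < c := hcn ▸ norm_pos_iff.2 (sub_ne_zero.2 hpx)
  set s := √(‖p.snd - y₀‖ ^ 2 + ε ^ 2) with hs
  have hs0 : 0 < s := hε0.trans_le (hsq p)
  -- The negative gradient of `f` at `p`: minimality and the quadratic upper bounds on both terms
  -- make it a regular normal.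
  set ξ : WithLp 2 (E × G) :=
    WithLp.toLp 2 (-(K • c⁻¹ • (p.fst - x₁)), -(s⁻¹ • (p.snd - y₀))) with hξ
  have hmem : ξ ∈ regularNormalCone (graph F) p := by
    refine mem_regularNormalCone_of_quadratic hp (C := K * (2 * c)⁻¹ + (2 * s)⁻¹)
      (by positivity) fun q hq => ?_
    have hfq : f p ≤ f q := hmin hq
    have h1 := sqrt_norm_sq_add_le (p.fst - x₁) (q.fst - x₁) le_rfl hc0
    have h2 := sqrt_norm_sq_add_le (p.snd - y₀) (q.snd - y₀) (sq_nonneg ε) hs0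
    rw [← hc, add_zero, Real.sqrt_sq (norm_nonneg _), sub_sub_sub_cancel_right] at h1
    rw [← hs, sub_sub_sub_cancel_right] at h2
    have h3 : ‖q.fst - p.fst‖ ^ 2 ≤ ‖q - p‖ ^ 2 := by
      gcongr
      exact WithLp.norm_fst_le E (q - p)
    have h4 : ‖q.snd - p.snd‖ ^ 2 ≤ ‖q - p‖ ^ 2 := by
      gcongr
      exact WithLp.norm_snd_le E (q - p)
    have h5 : ⟪ξ, q - p⟫ = -(K * ⟪c⁻¹ • (p.fst - x₁), q.fst - p.fst⟫) -
        ⟪s⁻¹ • (p.snd - y₀), q.snd - p.snd⟫ := by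
      rw [WithLp.prod_inner_apply]
      change ⟪-(K • c⁻¹ • (p.fst - x₁)), q.fst - p.fst⟫ +
        ⟪-(s⁻¹ • (p.snd - y₀)), q.snd - p.snd⟫ = _
      rw [inner_neg_left, inner_neg_left, real_inner_smul_left _ _ K]
      ring
    have h6 := mul_le_mul_of_nonneg_left h1 hK.le
    have h7 : K * (2 * c)⁻¹ * ‖q.fst - p.fst‖ ^ 2 ≤ K * (2 * c)⁻¹ * ‖q - p‖ ^ 2 := by gcongr
    have h8 : (2 * s)⁻¹ * ‖q.snd - p.snd‖ ^ 2 ≤ (2 * s)⁻¹ * ‖q - p‖ ^ 2 := by gcongr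
    simp only [hf, ← hs, ← hcn] at hfq
    rw [h5]
    linarith
  have hR : R < ‖p.fst‖ := by
    have h1 := norm_sub_le_norm_sub_add_norm_sub x₀ x₁ p.fst
    have h2 := norm_le_norm_sub_add x₀ p.fst
    rw [norm_sub_rev x₁] at h1
    linarith
  have hδ : ‖p.snd - ybar‖ < δ := by
    have h1 := norm_sub_le_norm_sub_add_norm_sub p.snd y₀ ybar
    linarith
  have hle := hN p hR hδ ξ hmem
  have h1 : ‖ξ.fst‖ = K := by
    change ‖-(K • c⁻¹ • (p.fst - x₁))‖ = K
    rw [norm_neg, norm_smul, norm_smul, Real.norm_of_nonneg hK.le, norm_inv,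
      Real.norm_of_nonneg hc0.le, ← hcn, inv_mul_cancel₀ hc0.ne', mul_one]
  have h2 : ‖ξ.snd‖ < 1 := by
    change ‖-(s⁻¹ • (p.snd - y₀))‖ < 1
    rw [norm_neg, norm_smul, norm_inv, Real.norm_of_nonneg hs0.le, inv_mul_lt_iff₀ hs0, mul_one]
    -- Strict because `ε > 0`: this is what the smoothing buys.
    exact Real.lt_sqrt_of_sq_lt (by nlinarith)
  rw [h1] at hle
  nlinarith

theorem exists_lipschitzLikeAtInfinity {F : E → Set G} (hF : IsClosed (graph F)) {ybar : G}
    (h : coderivativeAtInfinity F ybar 0 ⊆ {0}) :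
    ∃ R : ℝ, 0 < R ∧ ∃ ℓ : ℝ, 0 < ℓ ∧ ∃ V : Set G, IsOpen V ∧ ybar ∈ V ∧
      IsOpen (inverseImage F V \ Metric.closedBall 0 R) ∧ LipschitzLikeAtInfinity F R ℓ V := by
  obtain ⟨K, hK, R, hR, δ, hδ, hN⟩ := exists_norm_fst_le_of_coderivativeAtInfinity h
  -- Steps of length at most `ρ` move `y` by at most `δ / 2`, so the local estimate applies on the
  -- half ball.
  set ρ := δ / (4 * K) with hρ
  have hρ0 : 0 < ρ := by positivity
  have hKρ : 4 * K * ρ = δ := by rw [hρ]; field_simp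
  have hstep : ∀ x x' : E, ∀ y ∈ F x, R + 2 * ρ < ‖x‖ → y ∈ Metric.ball ybar (δ / 2) →
      ‖x - x'‖ ≤ ρ → ∃ y' ∈ F x', ‖y - y'‖ ≤ 2 * K * ‖x - x'‖ := by
    intro x x' y hy hx hyV hxx
    rw [Metric.mem_ball, dist_eq_norm] at hyV
    refine exists_mem_norm_sub_le_of_regularNormalCone hF hK hN hy (by linarith) ?_
    have : K * ‖x - x'‖ ≤ K * ρ := by gcongr
    linarith
  refine ⟨R + 2 * ρ, by positivity, 4 * K, by positivity, Metric.ball ybar (δ / 2),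
    Metric.isOpen_ball, Metric.mem_ball_self (by positivity), ?_, ?_⟩
  · rw [isOpen_iff_mem_nhds]
    rintro x ⟨⟨y, hy, hyV⟩, hxR⟩
    have hxR' : R + 2 * ρ < ‖x‖ := by simpa using hxR
    obtain ⟨r, hr, hrV⟩ := Metric.isOpen_iff.1 Metric.isOpen_ball y hyV
    filter_upwards [Metric.isClosed_closedBall.isOpen_compl.mem_nhds hxR,
      Metric.ball_mem_nhds x (lt_min hρ0 (show 0 < r / (2 * K) by positivity))] with x' hx' hb
    refine ⟨?_, hx'⟩
    rw [Metric.mem_ball', dist_eq_norm, lt_min_iff,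
      lt_div_iff₀ (show 0 < 2 * K by positivity)] at hb
    obtain ⟨y', hy', hyy⟩ := hstep x x' y hy hxR' hyV hb.1.le
    refine ⟨y', hy', hrV ?_⟩
    rw [Metric.mem_ball', dist_eq_norm]
    linarith
  · rintro x ⟨-, hxR⟩ x' ⟨⟨z, hz, hzV⟩, -⟩ y ⟨hy, hyV⟩
    suffices hy' : ∃ y' ∈ F x', ‖y - y'‖ ≤ 4 * K * ‖x - x'‖ by
      obtain ⟨y', hy', hyy⟩ := hy'
      exact Set.mem_add.2 ⟨y', hy', y - y', by simpa using hyy, add_sub_cancel _ _⟩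
    rcases le_or_gt ‖x - x'‖ ρ with hle | hgt
    · obtain ⟨y', hy', hyy⟩ := hstep x x' y hy (by simpa using hxR) hyV hle
      refine ⟨y', hy', ?_⟩
      have : 0 ≤ K * ‖x - x'‖ := by positivity
      linarith
    -- For distant points any `z` in `F x' ∩ V` works: `V` has diameter at most `δ = 4 * K * ρ`,
    -- which is why the constant is `4 * K`.
    · refine ⟨z, hz, ?_⟩
      rw [Metric.mem_ball, dist_eq_norm] at hyV hzV
      have h1 := norm_sub_le_norm_sub_add_norm_sub y ybar z
      rw [norm_sub_rev ybar] at h1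
      have h2 : 4 * K * ρ < 4 * K * ‖x - x'‖ := by gcongr
      linarith

end FiniteDimensional

end AtInfinity

end VarAnal

theorem theorem4p5 (n m : ℕ)
    (F : EuclideanSpace ℝ (Fin n) → Set (EuclideanSpace ℝ (Fin m)))
    (hF : IsClosed (VarAnal.graph F))
    (ybar : EuclideanSpace ℝ (Fin m)) (hy : ybar ∈ VarAnal.jelonekSet F) :
    List.TFAE
      [VarAnal.coderivativeAtInfinity F ybar 0 = {0},
       ∃ R : ℝ, 0 < R ∧ ∃ ℓ : ℝ, 0 < ℓ ∧ ∃ V : Set (EuclideanSpace ℝ (Fin m)),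
          IsOpen V ∧ ybar ∈ V ∧
          IsOpen (VarAnal.inverseImage F V \ Metric.closedBall 0 R) ∧
          VarAnal.LipschitzLikeAtInfinity F R ℓ V,
       ∃ R : ℝ, 0 < R ∧ ∃ ℓ : ℝ, 0 < ℓ ∧ ∃ V ∈ 𝓝 ybar,
          VarAnal.DistFunLocallyLipschitz F R ℓ V,
       VarAnal.distSingularLimits F ybar = {0}] ∧
    ∀ R : ℝ, 0 < R → ∀ ℓ : ℝ, 0 < ℓ → ∀ V ∈ 𝓝 ybar,
      VarAnal.DistFunLocallyLipschitz F R ℓ V →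
        ∀ w ∈ VarAnal.distSubgradientLimits F ybar, ‖w‖ ≤ ℓ := by
  refine ⟨?_, fun R _ ℓ hℓ V hV h w hw =>
    VarAnal.norm_le_of_mem_distSubgradientLimits hℓ.le hV h hw⟩
  tfae_have 1 → 2 := fun h => VarAnal.exists_lipschitzLikeAtInfinity hF h.subset
  tfae_have 2 → 3 := by
    rintro ⟨R, hR, ℓ, hℓ, V, hV, hyV, hO, h⟩
    exact ⟨R, hR, 1 + ℓ, by positivity, V, hV.mem_nhds hyV, h.distFunLocallyLipschitz hℓ hV hO⟩
  tfae_have 3 → 4 := by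
    rintro ⟨R, -, ℓ, hℓ, V, hV, h⟩
    exact VarAnal.distSingularLimits_eq_zero hℓ.le hy hV h
  tfae_have 4 → 1 := VarAnal.coderivativeAtInfinity_eq_zero_of_distSingularLimits hy
  tfae_finish
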